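/- Let $H$ be a non-zero complex Hilbert space and let $Q$ be a bounded linear operator on $H$ that is quadratic, i.e. $(Q-aI)(Q-bI)=0$ for some $a,b\in\mathbb{C}$, where $I$ is the identity operator on $H$. A bounded linear operator $T$ on $H$ is said to attain its norm if there is a unit vector $x\in H$ with $\|Tx\|=\|T\|$. Then the following statements are equivalent: (i) $Q$ attains its norm; (ii) for all $c,k\in\mathbb{C}$, the operator $Q+cQ^*+kI$ attains its norm; (iii) there exist $c,k\in\mathbb{C}$ such that the operator $Q+cQ^*+kI$ attains its norm. -/

import Mathlib

/-- A bounded linear operator `A : K → H` between complex normed spaces attains its norm if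
`‖A x‖ = ‖A‖` for some unit vector `x` of `K`. -/
def AttainsNorm {K H : Type*} [NormedAddCommGroup K] [NormedSpace ℂ K]
    [NormedAddCommGroup H] [NormedSpace ℂ H] (A : K →L[ℂ] H) : Prop :=
  ∃ x : K, ‖x‖ = 1 ∧ ‖A x‖ = ‖A‖

/-- A bounded linear operator `Q` on `H` is a quadratic operator if `(Q - a I)(Q - b I) = 0` for
some complex numbers `a` and `b`. -/
def IsQuadraticOperator {H : Type*} [NormedAddCommGroup H] [NormedSpace ℂ H]
    (Q : H →L[ℂ] H) : Prop :=
  ∃ a b : ℂ, (Q - a • ContinuousLinearMap.id ℂ H) ∘L (Q - b • ContinuousLinearMap.id ℂ H) = 0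

/-!
Let `K = ker (Q - a)` and let `P` be the orthogonal projection onto `K`. Since
`(Q - a)(Q - b) = 0`, the range of `Q - b` lies in `K`, so that `Q = a P + b (1 - P) + D` with
`D = (Q - b)(1 - P)` mapping `Kᗮ` into `K` and vanishing on `K`. Consequently every operator
`T = Q + c Q* + k` has the block form `α P + β (1 - P) + D + c D*`, with the same corner `D`.

If `D = 0`, then `T` is a direct sum of two scalar operators and attains its norm. If `D ≠ 0`, then
`T` attains its norm if and only if `D` does (`attainsNorm_blockOp_iff`), a condition in which
`c` and `k` do not occur. To see this, expand, for `x = x₁ + x₂` with `x₁ ∈ K` and `x₂ ∈ Kᗮ`,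
`‖T x‖² = |α|²‖x₁‖² + |c|²‖D* x₁‖² + 2 Re (γ ⟪x₁, D x₂⟫) + ‖D x₂‖² + |β|²‖x₂‖²`
with `γ = conj α + conj c * β`. Estimating each term by the norm of `D` bounds this by the value at
`(‖x₁‖, ‖x₂‖)` of the real quadratic form `blockForm` with parameter `‖D‖`. Conversely, test vectors
in the span of `v` and `D v`, with `v ∈ Kᗮ` almost maximizing `‖D v‖`, show that `‖T‖²` is the
maximum of this form on the quarter of the unit circle where both coordinates are nonnegative. If
`D` attains its norm, the test vectors reach the maximum. If `T` attains its norm at `x`, all the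
estimates above are equalities at `x`; so, up to normalization, `D` attains its norm at `x₂`, or
`D*` attains its norm at `x₁`, unless `x₂ = 0` and `c = 0`, where the form would be maximal at
`(1, 0)`, which `D ≠ 0` rules out.
-/

open scoped InnerProductSpace ComplexConjugate

/-! ### Norm attainment -/

section Attainment

variable {E F : Type*} [NormedAddCommGroup E] [NormedSpace ℂ E]
  [NormedAddCommGroup F] [NormedSpace ℂ F]

theorem attainsNorm_of_forall_le {A : E →L[ℂ] F} {x : E} (hx : ‖x‖ = 1)
    (h : ∀ y, ‖y‖ = 1 → ‖A y‖ ≤ ‖A x‖) : AttainsNorm A := by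
  refine ⟨x, hx, le_antisymm ?_ ?_⟩
  · simpa [hx] using A.le_opNorm x
  · refine A.opNorm_le_of_unit_norm (norm_nonneg _) h

theorem attainsNorm_of_opNorm_mul_le {A : E →L[ℂ] F} {x : E} (hx : x ≠ 0)
    (h : ‖A‖ * ‖x‖ ≤ ‖A x‖) : AttainsNorm A := by
  have hx' : ‖x‖ ≠ 0 := norm_ne_zero_iff.mpr hx
  refine ⟨((‖x‖⁻¹ : ℝ) : ℂ) • x, ?_, ?_⟩
  · simp [norm_smul, hx']
  · rw [map_smul, norm_smul, le_antisymm (A.le_opNorm x) h]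
    simp only [Complex.norm_real, norm_inv, norm_norm]
    field_simp

end Attainment

section Adjoint

variable {H : Type*} [NormedAddCommGroup H] [InnerProductSpace ℂ H] [CompleteSpace H]

theorem norm_sq_le_norm_mul_norm_adjoint (D : H →L[ℂ] H) (v : H) :
    ‖D v‖ ^ 2 ≤ ‖v‖ * ‖D.adjoint (D v)‖ := by
  have h := norm_inner_le_norm (𝕜 := ℂ) v (D.adjoint (D v))
  rw [ContinuousLinearMap.adjoint_inner_right, inner_self_eq_norm_sq_to_K] at h
  simpa using h

theorem AttainsNorm.of_adjoint {D : H →L[ℂ] H} (h : AttainsNorm D.adjoint) :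
    AttainsNorm D := by
  obtain ⟨x, hx, h⟩ := h
  rw [LinearIsometryEquiv.norm_map] at h
  by_cases hD : D = 0
  · exact ⟨x, hx, by simp [hD]⟩
  have hd : 0 < ‖D‖ := norm_pos_iff.mpr hD
  refine attainsNorm_of_opNorm_mul_le (x := D.adjoint x) (norm_pos_iff.mp (h ▸ hd)) ?_
  have := norm_sq_le_norm_mul_norm_adjoint D.adjoint x
  rw [ContinuousLinearMap.adjoint_adjoint, hx, one_mul] at this
  rw [h] at this ⊢
  nlinarith

theorem norm_adjoint_apply_le (D : H →L[ℂ] H) (u : H) : ‖D.adjoint u‖ ≤ ‖D‖ * ‖u‖ := by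
  simpa [LinearIsometryEquiv.norm_map] using D.adjoint.le_opNorm u

theorem adjoint_mem_orthogonal {K : Submodule ℂ H} {D : H →L[ℂ] H} (h0 : ∀ x ∈ K, D x = 0)
    (x : H) : D.adjoint x ∈ Kᗮ := by
  rw [Submodule.mem_orthogonal]
  intro u hu
  rw [ContinuousLinearMap.adjoint_inner_right, h0 u hu, inner_zero_left]

theorem adjoint_apply_of_mem_orthogonal {K : Submodule ℂ H} {D : H →L[ℂ] H}
    (hK : ∀ x, D x ∈ K) {x : H} (hx : x ∈ Kᗮ) :
    D.adjoint x = 0 := by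
  refine ext_inner_left ℂ fun v => ?_
  rw [ContinuousLinearMap.adjoint_inner_right, inner_zero_right]
  exact (Submodule.mem_orthogonal K x).mp hx _ (hK v)

end Adjoint

/-! ### Block operators -/

theorem norm_add_sq_of_mem_orthogonal {H : Type*} [NormedAddCommGroup H]
    [InnerProductSpace ℂ H] {K : Submodule ℂ H} {u v : H} (hu : u ∈ K) (hv : v ∈ Kᗮ) :
    ‖u + v‖ ^ 2 = ‖u‖ ^ 2 + ‖v‖ ^ 2 := by
  simpa only [sq] using norm_add_sq_eq_norm_sq_add_norm_sq_of_inner_eq_zero (𝕜 := ℂ) u v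
    ((Submodule.mem_orthogonal K v).mp hv u hu)

theorem apply_starProjection_orthogonal {H : Type*} [NormedAddCommGroup H]
    [InnerProductSpace ℂ H] {K : Submodule ℂ H} [K.HasOrthogonalProjection] {D : H →L[ℂ] H}
    (h0 : ∀ x ∈ K, D x = 0) (x : H) :
    D (Kᗮ.starProjection x) = D x := by
  rw [Submodule.starProjection_orthogonal_val, map_sub, h0 _ (K.starProjection_apply_mem x),
    sub_zero]

theorem exists_norm_eq_one_mul_conj_eq_norm (γ : ℂ) : ∃ η : ℂ, ‖η‖ = 1 ∧ γ * conj η = ‖γ‖ := by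
  by_cases h : γ = 0
  · exact ⟨1, by simp, by simp [h]⟩
  have h' : (‖γ‖ : ℂ) ≠ 0 := by exact_mod_cast norm_ne_zero_iff.mpr h
  refine ⟨γ / ‖γ‖, by simp [h], ?_⟩
  rw [map_div₀, Complex.conj_ofReal, mul_div_assoc', Complex.mul_conj, Complex.normSq_eq_norm_sq]
  push_cast
  field_simp

section Block

variable {H : Type*} [NormedAddCommGroup H] [InnerProductSpace ℂ H] [CompleteSpace H]

/-- The operator `α P + β (1 - P) + D + c D*`, where `P` is the orthogonal projection onto `K`. It
is the block matrix with rows `(α, D)` and `(c D*, β)` when `D` maps `H` into `K` and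
vanishes on `K`. -/
noncomputable def blockOp (K : Submodule ℂ H) [K.HasOrthogonalProjection] (D : H →L[ℂ] H)
    (α β c : ℂ) : H →L[ℂ] H :=
  α • K.starProjection + β • Kᗮ.starProjection + D + c • D.adjoint

/-- The real quadratic form in `(p, r)` that results from `‖blockOp K D α β c x‖ ^ 2` on replacing
the components of `x` in `K` and `Kᗮ` by their norms `p` and `r`, the operator `D` by its norm `e`,
and the coefficient of the cross term by its modulus. -/
noncomputable def blockForm (α β c : ℂ) (e p r : ℝ) : ℝ :=
  ‖α‖ ^ 2 * p ^ 2 + ‖c‖ ^ 2 * (e * p) ^ 2 + 2 * (‖conj α + conj c * β‖ * (p * (e * r)))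
    + (e * r) ^ 2 + ‖β‖ ^ 2 * r ^ 2

variable {K : Submodule ℂ H} [K.HasOrthogonalProjection] {D : H →L[ℂ] H} {α β c : ℂ}

theorem blockOp_add (hK : ∀ x, D x ∈ K) (h0 : ∀ x ∈ K, D x = 0) {u v : H} (hu : u ∈ K)
    (hv : v ∈ Kᗮ) :
    blockOp K D α β c (u + v) = (α • u + D v) + (c • D.adjoint u + β • v) := by
  have h1 : K.starProjection u = u := Submodule.starProjection_eq_self_iff.mpr hu
  have h2 : K.starProjection v = 0 := by
    rw [Submodule.starProjection_apply_eq_zero_iff]; exact hv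
  have h3 : Kᗮ.starProjection v = v := Submodule.starProjection_eq_self_iff.mpr hv
  have h4 : Kᗮ.starProjection u = 0 := by
    rw [Submodule.starProjection_apply_eq_zero_iff]; exact K.le_orthogonal_orthogonal hu
  simp only [blockOp, _root_.add_apply, _root_.smul_apply, map_add,
    h1, h2, h3, h4, h0 u hu, adjoint_apply_of_mem_orthogonal hK hv]
  simp only [smul_zero, add_zero, zero_add]
  abel

theorem norm_blockOp_add_sq (hK : ∀ x, D x ∈ K) (h0 : ∀ x ∈ K, D x = 0) {u v : H} (hu : u ∈ K)
    (hv : v ∈ Kᗮ) :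
    ‖blockOp K D α β c (u + v)‖ ^ 2 = ‖α‖ ^ 2 * ‖u‖ ^ 2 + ‖c‖ ^ 2 * ‖D.adjoint u‖ ^ 2
      + 2 * ((conj α + conj c * β) * ⟪u, D v⟫_ℂ).re + ‖D v‖ ^ 2 + ‖β‖ ^ 2 * ‖v‖ ^ 2 := by
  rw [blockOp_add hK h0 hu hv, norm_add_sq_of_mem_orthogonal
    (K.add_mem (K.smul_mem _ hu) (hK v))
    (Kᗮ.add_mem (Kᗮ.smul_mem _ (adjoint_mem_orthogonal h0 u)) (Kᗮ.smul_mem _ hv)),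
    norm_add_sq (𝕜 := ℂ), norm_add_sq (𝕜 := ℂ)]
  simp only [inner_smul_left, inner_smul_right, ContinuousLinearMap.adjoint_inner_left, norm_smul,
    RCLike.re_eq_complex_re, add_mul, Complex.add_re, mul_pow]
  rw [show conj c * β * ⟪u, D v⟫_ℂ = β * (conj c * ⟪u, D v⟫_ℂ) by ring]
  ring

/-- Only the cross term is estimated here: keeping `‖D.adjoint u‖` and `‖D v‖` makes it possible to
read off norm attainment of `D` from the equality case. -/
theorem norm_blockOp_add_sq_le (hK : ∀ x, D x ∈ K) (h0 : ∀ x ∈ K, D x = 0) {u v : H}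
    (hu : u ∈ K) (hv : v ∈ Kᗮ) :
    ‖blockOp K D α β c (u + v)‖ ^ 2 ≤ ‖α‖ ^ 2 * ‖u‖ ^ 2 + ‖c‖ ^ 2 * ‖D.adjoint u‖ ^ 2
      + 2 * (‖conj α + conj c * β‖ * (‖u‖ * (‖D‖ * ‖v‖))) + ‖D v‖ ^ 2 + ‖β‖ ^ 2 * ‖v‖ ^ 2 := by
  rw [norm_blockOp_add_sq hK h0 hu hv]
  have h : ((conj α + conj c * β) * ⟪u, D v⟫_ℂ).re
      ≤ ‖conj α + conj c * β‖ * (‖u‖ * (‖D‖ * ‖v‖)) := by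
    refine (Complex.re_le_norm _).trans ?_
    rw [norm_mul]
    gcongr
    exact (norm_inner_le_norm _ _).trans (by gcongr; exact D.le_opNorm v)
  linarith

theorem norm_blockOp_add_sq_le_blockForm (hK : ∀ x, D x ∈ K) (h0 : ∀ x ∈ K, D x = 0) {u v : H}
    (hu : u ∈ K) (hv : v ∈ Kᗮ) :
    ‖blockOp K D α β c (u + v)‖ ^ 2 ≤ blockForm α β c ‖D‖ ‖u‖ ‖v‖ := by
  refine (norm_blockOp_add_sq_le hK h0 hu hv).trans ?_
  unfold blockForm
  gcongr
  · exact norm_adjoint_apply_le D u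
  · exact D.le_opNorm v

/-- The test vectors: every unit vector `v ∈ Kᗮ` with `D v ≠ 0` yields a combination of `D v` and
`v` at which the squared norm of the block operator is at least the value of `blockForm` with
parameter `‖D v‖`. -/
theorem exists_blockForm_le_norm_blockOp_sq (hK : ∀ x, D x ∈ K) (h0 : ∀ x ∈ K, D x = 0) {v : H}
    (hv : v ∈ Kᗮ) (hv1 : ‖v‖ = 1) (hDv : D v ≠ 0) {p r : ℝ} (hp : 0 ≤ p) (hr : 0 ≤ r) :
    ∃ y : H, ‖y‖ ^ 2 = p ^ 2 + r ^ 2 ∧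
      blockForm α β c ‖D v‖ p r ≤ ‖blockOp K D α β c y‖ ^ 2 := by
  obtain ⟨η, hη, hη'⟩ := exists_norm_eq_one_mul_conj_eq_norm (conj α + conj c * β)
  have he : 0 < ‖D v‖ := norm_pos_iff.mpr hDv
  have hadj : ‖D v‖ ^ 2 ≤ ‖D.adjoint (D v)‖ := by
    simpa [hv1] using norm_sq_le_norm_mul_norm_adjoint D v
  have hinner := inner_self_eq_norm_sq_to_K (𝕜 := ℂ) (D v)
  set e := ‖D v‖ with he_def
  -- The phase `η` makes the cross term real and as large as possible.
  set s : ℂ := ((p / e : ℝ) : ℂ) * η with hs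
  have hsn : ‖s‖ = p / e := by
    rw [hs, norm_mul, hη, mul_one, Complex.norm_real, Real.norm_of_nonneg (by positivity)]
  have hu : s • D v ∈ K := K.smul_mem _ (hK v)
  have hrv : (r : ℂ) • v ∈ Kᗮ := Kᗮ.smul_mem _ hv
  have hnu : ‖s • D v‖ = p := by
    rw [norm_smul, hsn, ← he_def]; field_simp
  have hnv : ‖(r : ℂ) • v‖ = r := by
    rw [norm_smul, hv1, mul_one, Complex.norm_real, Real.norm_of_nonneg hr]
  refine ⟨s • D v + (r : ℂ) • v, ?_, ?_⟩
  · rw [norm_add_sq_of_mem_orthogonal hu hrv, hnu, hnv]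
  · rw [norm_blockOp_add_sq hK h0 hu hrv, hnu, hnv]
    have h1 : e * p ≤ ‖D.adjoint (s • D v)‖ := by
      rw [map_smul, norm_smul, hsn]
      calc e * p = p / e * e ^ 2 := by field_simp
        _ ≤ _ := by gcongr
    have h2 : ‖D ((r : ℂ) • v)‖ = e * r := by
      rw [map_smul, norm_smul, Complex.norm_real, Real.norm_of_nonneg hr, mul_comm]
    have h3 : (conj α + conj c * β) * ⟪s • D v, D ((r : ℂ) • v)⟫_ℂ
        = ((‖conj α + conj c * β‖ * (p * (e * r)) : ℝ) : ℂ) := by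
      have hec : (e : ℂ) ≠ 0 := by exact_mod_cast he.ne'
      rw [map_smul, inner_smul_left, inner_smul_right, hinner, hs, map_mul, Complex.conj_ofReal]
      calc _ = ((conj α + conj c * β) * conj η) * (((p / e : ℝ) : ℂ) * (r * (e : ℂ) ^ 2)) := by
            simp only [Complex.coe_algebraMap]; ring
        _ = _ := by
            rw [hη']; push_cast; field_simp
    rw [h3, Complex.ofReal_re, h2]
    unfold blockForm
    gcongr

/-- The lower bound for `‖blockOp K D α β c‖`; as `D` need not attain its norm, it is obtained from
parameters `e < ‖D‖` by letting `e` tend to `‖D‖`. -/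
theorem blockForm_le_opNorm_sq (hK : ∀ x, D x ∈ K) (h0 : ∀ x ∈ K, D x = 0) (hD : D ≠ 0)
    {p r : ℝ} (hp : 0 ≤ p) (hr : 0 ≤ r) :
    blockForm α β c ‖D‖ p r ≤ ‖blockOp K D α β c‖ ^ 2 * (p ^ 2 + r ^ 2) := by
  have hd : 0 < ‖D‖ := norm_pos_iff.mpr hD
  have hcont : Continuous fun e : ℝ => blockForm α β c e p r := by
    unfold blockForm; fun_prop
  have key : ∀ e ∈ Set.Ioo 0 ‖D‖,
      blockForm α β c e p r ≤ ‖blockOp K D α β c‖ ^ 2 * (p ^ 2 + r ^ 2) := by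
    rintro e ⟨he0, he⟩
    obtain ⟨x, hx1, hx⟩ := D.exists_lt_apply_of_lt_opNorm he
    set w := Kᗮ.starProjection x with hw
    have hDw : D w = D x := apply_starProjection_orthogonal h0 x
    have hw1 : ‖w‖ ≤ 1 := (Kᗮ.norm_starProjection_apply_le x).trans hx1.le
    have hDw0 : D w ≠ 0 := norm_pos_iff.mp (by rw [hDw]; exact he0.trans hx)
    have hw0 : 0 < ‖w‖ := norm_pos_iff.mpr fun h => hDw0 (by rw [h, map_zero])
    set v := ((‖w‖⁻¹ : ℝ) : ℂ) • w with hv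
    have hDv : ‖D v‖ = ‖w‖⁻¹ * ‖D w‖ := by simp [hv, norm_smul]
    have hv1 : ‖v‖ = 1 := by simp [hv, norm_smul, hw0.ne']
    have hev : e ≤ ‖D v‖ := by
      rw [hDv, hDw]
      exact hx.le.trans (le_mul_of_one_le_left (norm_nonneg _) ((one_le_inv₀ hw0).mpr hw1))
    obtain ⟨y, hy, hyT⟩ := exists_blockForm_le_norm_blockOp_sq (α := α) (β := β) (c := c) hK h0
      (Kᗮ.smul_mem ((‖w‖⁻¹ : ℝ) : ℂ) (Kᗮ.starProjection_apply_mem x)) hv1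
      (norm_pos_iff.mp (he0.trans_le hev)) hp hr
    calc blockForm α β c e p r ≤ blockForm α β c ‖D v‖ p r := by
          unfold blockForm; gcongr
      _ ≤ ‖blockOp K D α β c y‖ ^ 2 := hyT
      _ ≤ (‖blockOp K D α β c‖ * ‖y‖) ^ 2 := by
          gcongr; exact (blockOp K D α β c).le_opNorm y
      _ = _ := by rw [mul_pow, hy]
  refine le_of_tendsto (hcont.continuousWithinAt (s := Set.Iio ‖D‖) (x := ‖D‖)) ?_
  filter_upwards [Ioo_mem_nhdsLT hd] with e he using key e he

theorem exists_blockForm_max (α β c : ℂ) (e : ℝ) : ∃ p r : ℝ, 0 ≤ p ∧ 0 ≤ r ∧ p ^ 2 + r ^ 2 = 1 ∧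
    ∀ p' r' : ℝ, 0 ≤ p' → 0 ≤ r' → p' ^ 2 + r' ^ 2 = 1 →
      blockForm α β c e p' r' ≤ blockForm α β c e p r := by
  have hcomp : IsCompact (Set.Icc (0 : ℝ × ℝ) 1 ∩ {z | z.1 ^ 2 + z.2 ^ 2 = 1}) :=
    isCompact_Icc.inter_right (isClosed_eq (by fun_prop) (by fun_prop))
  obtain ⟨z, ⟨hz, hz1⟩, hmax⟩ := hcomp.exists_isMaxOn
    (f := fun z : ℝ × ℝ => blockForm α β c e z.1 z.2)
    ⟨(1, 0), ⟨⟨by simp [Prod.le_def], by simp [Prod.le_def]⟩, by simp⟩⟩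
    (by unfold blockForm; fun_prop)
  refine ⟨z.1, z.2, hz.1.1, hz.1.2, hz1, fun p' r' hp hr h => ?_⟩
  exact hmax (a := (p', r')) ⟨⟨⟨hp, hr⟩, ⟨show p' ≤ 1 by nlinarith, show r' ≤ 1 by nlinarith⟩⟩, h⟩

theorem attainsNorm_blockOp (hK : ∀ x, D x ∈ K) (h0 : ∀ x ∈ K, D x = 0) (hD : D ≠ 0)
    (h : AttainsNorm D) : AttainsNorm (blockOp K D α β c) := by
  obtain ⟨x, hx1, hx⟩ := h
  have hd : 0 < ‖D‖ := norm_pos_iff.mpr hD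
  set v := Kᗮ.starProjection x with hv
  have hDv : ‖D v‖ = ‖D‖ := by rw [hv, apply_starProjection_orthogonal h0, hx]
  have hv1 : ‖v‖ = 1 := by
    refine le_antisymm ((Kᗮ.norm_starProjection_apply_le x).trans hx1.le) ?_
    have := D.le_opNorm v
    rw [hDv] at this
    nlinarith
  obtain ⟨p, r, hp, hr, hpr, hmax⟩ := exists_blockForm_max α β c ‖D‖
  obtain ⟨y, hy, hyT⟩ := exists_blockForm_le_norm_blockOp_sq (α := α) (β := β) (c := c) hK h0
    (Kᗮ.starProjection_apply_mem x) hv1 (norm_pos_iff.mp (hDv ▸ hd)) hp hr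
  rw [← hv, hDv] at hyT
  rw [hpr] at hy
  refine attainsNorm_of_forall_le (x := y) (by nlinarith [norm_nonneg y]) fun z hz => ?_
  refine le_of_sq_le_sq ?_ (norm_nonneg _)
  rw [← K.starProjection_add_starProjection_orthogonal z]
  have hzs := norm_add_sq_of_mem_orthogonal (K.starProjection_apply_mem z)
    (Kᗮ.starProjection_apply_mem z)
  rw [K.starProjection_add_starProjection_orthogonal z, hz, one_pow] at hzs
  exact (norm_blockOp_add_sq_le_blockForm hK h0 (K.starProjection_apply_mem z)
    (Kᗮ.starProjection_apply_mem z)).trans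
    ((hmax _ _ (norm_nonneg _) (norm_nonneg _) hzs.symm).trans hyT)

theorem attainsNorm_of_attainsNorm_blockOp (hK : ∀ x, D x ∈ K) (h0 : ∀ x ∈ K, D x = 0)
    (hD : D ≠ 0) (h : AttainsNorm (blockOp K D α β c)) : AttainsNorm D := by
  obtain ⟨x, hx1, hx⟩ := h
  have hd : 0 < ‖D‖ := norm_pos_iff.mpr hD
  obtain ⟨u, hu, v, hv, rfl⟩ : ∃ u ∈ K, ∃ v ∈ Kᗮ, x = u + v :=
    ⟨_, K.starProjection_apply_mem x, _, Kᗮ.starProjection_apply_mem x,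
      (K.starProjection_add_starProjection_orthogonal x).symm⟩
  have huv := norm_add_sq_of_mem_orthogonal hu hv
  rw [hx1, one_pow] at huv
  have hlow (p r : ℝ) (hp : 0 ≤ p) (hr : 0 ≤ r) :=
    blockForm_le_opNorm_sq (α := α) (β := β) (c := c) hK h0 hD hp hr
  have hupp := norm_blockOp_add_sq_le (α := α) (β := β) (c := c) hK h0 hu hv
  have hlow1 := hlow _ _ (norm_nonneg u) (norm_nonneg v)
  rw [← huv, mul_one, ← hx] at hlow1
  have hDv : ‖D v‖ ≤ ‖D‖ * ‖v‖ := D.le_opNorm v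
  have hDu : ‖D.adjoint u‖ ≤ ‖D‖ * ‖u‖ := norm_adjoint_apply_le D u
  have hDv2 : ‖D v‖ ^ 2 ≤ (‖D‖ * ‖v‖) ^ 2 := by gcongr
  have hDu2 : ‖c‖ ^ 2 * ‖D.adjoint u‖ ^ 2 ≤ ‖c‖ ^ 2 * (‖D‖ * ‖u‖) ^ 2 := by gcongr
  have hchain := hlow1.trans hupp
  unfold blockForm at hchain
  by_cases hv0 : v = 0
  · subst hv0
    rw [norm_zero] at huv
    have hu1 : ‖u‖ = 1 := by nlinarith [norm_nonneg u]
    by_cases hc : c = 0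
    · -- The form would be maximal at `(1, 0)`, but it exceeds `‖α‖ ^ 2` in direction `(‖α‖, ‖D‖)`.
      subst hc
      exfalso
      have hT : ‖blockOp K D α β 0‖ ^ 2 ≤ ‖α‖ ^ 2 := by
        rw [← hx]
        simpa [hu1] using hupp
      have h2 := hlow ‖α‖ ‖D‖ (norm_nonneg _) hd.le
      have h3 := mul_le_mul_of_nonneg_right hT (by positivity : 0 ≤ ‖α‖ ^ 2 + ‖D‖ ^ 2)
      have h4 := h2.trans h3
      simp only [blockForm, norm_zero, map_zero, zero_mul, add_zero, RCLike.norm_conj] at h4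
      have : 0 < ‖D‖ ^ 4 := by positivity
      have : 0 ≤ ‖β‖ ^ 2 * ‖D‖ ^ 2 := by positivity
      have : 0 ≤ ‖α‖ ^ 2 * ‖D‖ ^ 2 := by positivity
      nlinarith
    · refine AttainsNorm.of_adjoint (attainsNorm_of_opNorm_mul_le (x := u) ?_ ?_)
      · exact norm_pos_iff.mp (by rw [hu1]; exact one_pos)
      · rw [LinearIsometryEquiv.norm_map]
        have hc' : 0 < ‖c‖ ^ 2 := by have := norm_pos_iff.mpr hc; positivity
        refine le_of_sq_le_sq (le_of_mul_le_mul_left ?_ hc') (norm_nonneg _)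
        linarith
  · refine attainsNorm_of_opNorm_mul_le hv0 (le_of_sq_le_sq ?_ (norm_nonneg _))
    linarith

/-- Whether a block operator with nonzero corner `D` attains its norm depends on `D` alone, not on
the scalars `α`, `β`, `c`. -/
theorem attainsNorm_blockOp_iff (hK : ∀ x, D x ∈ K) (h0 : ∀ x ∈ K, D x = 0) (hD : D ≠ 0) :
    AttainsNorm (blockOp K D α β c) ↔ AttainsNorm D :=
  ⟨attainsNorm_of_attainsNorm_blockOp hK h0 hD, attainsNorm_blockOp hK h0 hD⟩

theorem attainsNorm_blockOp_zero [Nontrivial H] (K : Submodule ℂ H) [K.HasOrthogonalProjection]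
    (α β c : ℂ) : AttainsNorm (blockOp K 0 α β c) := by
  have hn {u v : H} (hu : u ∈ K) (hv : v ∈ Kᗮ) :
      ‖blockOp K 0 α β c (u + v)‖ ^ 2 = ‖α‖ ^ 2 * ‖u‖ ^ 2 + ‖β‖ ^ 2 * ‖v‖ ^ 2 := by
    rw [norm_blockOp_add_sq (by simp) (by simp) hu hv]
    simp
  have hz (z : H) (hz : ‖z‖ = 1) : ∃ u ∈ K, ∃ v ∈ Kᗮ, z = u + v ∧ ‖u‖ ^ 2 + ‖v‖ ^ 2 = 1 := by
    refine ⟨_, K.starProjection_apply_mem z, _, Kᗮ.starProjection_apply_mem z,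
      (K.starProjection_add_starProjection_orthogonal z).symm, ?_⟩
    rw [← norm_add_sq_of_mem_orthogonal (K.starProjection_apply_mem z)
      (Kᗮ.starProjection_apply_mem z), K.starProjection_add_starProjection_orthogonal z, hz,
      one_pow]
  -- The norm is attained in the summand carrying the larger scalar, or in the only nonzero one.
  by_cases h1 : (∃ u ∈ K, u ≠ 0) ∧ (‖β‖ ≤ ‖α‖ ∨ ∀ v ∈ Kᗮ, v = 0)
  · obtain ⟨⟨u, hu, hu0⟩, h⟩ := h1
    obtain ⟨u, hu, hu1⟩ : ∃ u ∈ K, ‖u‖ = 1 :=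
      ⟨((‖u‖⁻¹ : ℝ) : ℂ) • u, K.smul_mem _ hu, by simp [norm_smul, hu0]⟩
    refine attainsNorm_of_forall_le hu1 fun z hz1 => le_of_sq_le_sq ?_ (norm_nonneg _)
    obtain ⟨u', hu', v', hv', rfl, h'⟩ := hz z hz1
    have hu2 := hn hu Kᗮ.zero_mem
    rw [add_zero, hu1, norm_zero] at hu2
    rw [hn hu' hv', hu2]
    rcases h with h | h
    · have : ‖β‖ ^ 2 * ‖v'‖ ^ 2 ≤ ‖α‖ ^ 2 * ‖v'‖ ^ 2 := by gcongr
      nlinarith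
    · rw [h v' hv', norm_zero] at h' ⊢
      nlinarith
  · obtain ⟨v, hv, hv0, h⟩ : ∃ v ∈ Kᗮ, v ≠ 0 ∧ (‖α‖ ≤ ‖β‖ ∨ ∀ u ∈ K, u = 0) := by
      by_cases h2 : ∃ u ∈ K, u ≠ 0
      · have h3 : ¬(‖β‖ ≤ ‖α‖ ∨ ∀ v ∈ Kᗮ, v = 0) := fun h => h1 ⟨h2, h⟩
        push Not at h3
        obtain ⟨v, hv, hv0⟩ := h3.2
        exact ⟨v, hv, hv0, Or.inl h3.1.le⟩
      · push Not at h2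
        obtain ⟨z, hz⟩ := exists_ne (0 : H)
        refine ⟨z, ?_, hz, Or.inr h2⟩
        rw [Submodule.mem_orthogonal]
        intro u hu
        rw [h2 u hu, inner_zero_left]
    obtain ⟨v, hv, hv1⟩ : ∃ v ∈ Kᗮ, ‖v‖ = 1 :=
      ⟨((‖v‖⁻¹ : ℝ) : ℂ) • v, Kᗮ.smul_mem _ hv, by simp [norm_smul, hv0]⟩
    refine attainsNorm_of_forall_le hv1 fun z hz1 => le_of_sq_le_sq ?_ (norm_nonneg _)
    obtain ⟨u', hu', v', hv', rfl, h'⟩ := hz z hz1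
    have hv2 := hn K.zero_mem hv
    rw [zero_add, hv1, norm_zero] at hv2
    rw [hn hu' hv', hv2]
    rcases h with h | h
    · have : ‖α‖ ^ 2 * ‖u'‖ ^ 2 ≤ ‖β‖ ^ 2 * ‖u'‖ ^ 2 := by gcongr
      nlinarith
    · rw [h u' hu', norm_zero] at h' ⊢
      nlinarith

end Block

/-! ### Quadratic operators -/

section Quadratic

variable {H : Type*} [NormedAddCommGroup H] [InnerProductSpace ℂ H] [CompleteSpace H]

/-- The block form of a quadratic operator `Q`, relative to `K = ker (Q - a)`, passes to every
`Q + c Q* + k` with the same corner `D`. -/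
theorem IsQuadraticOperator.exists_blockOp {Q : H →L[ℂ] H} (hQ : IsQuadraticOperator Q) :
    ∃ (K : Submodule ℂ H) (_ : K.HasOrthogonalProjection) (D : H →L[ℂ] H),
      (∀ x, D x ∈ K) ∧ (∀ x ∈ K, D x = 0) ∧
      ∀ c k : ℂ, ∃ α β : ℂ,
        Q + c • ContinuousLinearMap.adjoint Q + k • ContinuousLinearMap.id ℂ H
          = blockOp K D α β c := by
  obtain ⟨a, b, hab⟩ := hQ
  let A : H →L[ℂ] H := Q - a • ContinuousLinearMap.id ℂ H
  let K : Submodule ℂ H := LinearMap.ker (A : H →ₗ[ℂ] H)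
  have hmem (x : H) : x ∈ K ↔ Q x = a • x := by
    simp [K, A, LinearMap.mem_ker, sub_eq_zero]
  have : CompleteSpace K := (ContinuousLinearMap.isClosed_ker A).completeSpace_coe
  let D : H →L[ℂ] H := (Q - b • ContinuousLinearMap.id ℂ H) ∘L Kᗮ.starProjection
  have hQP : Q = a • K.starProjection + b • Kᗮ.starProjection + D := by
    ext x
    have h1 := (hmem _).mp (K.starProjection_apply_mem x)
    have h2 : Q x = Q (K.starProjection x) + Q (Kᗮ.starProjection x) := by
      rw [← map_add, K.starProjection_add_starProjection_orthogonal]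
    simp only [D, _root_.add_apply, _root_.smul_apply,
      ContinuousLinearMap.comp_apply, _root_.sub_apply, ContinuousLinearMap.id_apply]
    rw [h2, h1]
    abel
  have hQadj : Q.adjoint = conj a • K.starProjection + conj b • Kᗮ.starProjection + D.adjoint := by
    conv_lhs => rw [hQP]
    have hs (L : Submodule ℂ H) [L.HasOrthogonalProjection] :
        ContinuousLinearMap.adjoint L.starProjection = L.starProjection :=
      isSelfAdjoint_starProjection L
    simp only [map_add, map_smulₛₗ, hs]
  refine ⟨K, inferInstance, D, fun x => ?_, fun x hx => ?_, fun c k =>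
    ⟨a + c * conj a + k, b + c * conj b + k, ?_⟩⟩
  · exact LinearMap.mem_ker.mpr (DFunLike.congr_fun hab (Kᗮ.starProjection x))
  · have h : Kᗮ.starProjection x = 0 := by
      rw [Submodule.starProjection_apply_eq_zero_iff]; exact K.le_orthogonal_orthogonal hx
    simp only [D, ContinuousLinearMap.comp_apply, h, map_zero]
  · rw [hQadj]
    conv_lhs => rw [hQP]
    have hid : ContinuousLinearMap.id ℂ H = K.starProjection + Kᗮ.starProjection := by
      ext x
      exact (K.starProjection_add_starProjection_orthogonal x).symm
    rw [hid, blockOp]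
    module

end Quadratic

theorem mainTheorem4 {H : Type*} [NormedAddCommGroup H] [InnerProductSpace ℂ H]
    [CompleteSpace H] [Nontrivial H] (Q : H →L[ℂ] H) (hQ : IsQuadraticOperator Q) :
    List.TFAE [
      AttainsNorm Q,
      ∀ c k : ℂ, AttainsNorm
        (Q + c • ContinuousLinearMap.adjoint Q + k • ContinuousLinearMap.id ℂ H),
      ∃ c k : ℂ, AttainsNorm
        (Q + c • ContinuousLinearMap.adjoint Q + k • ContinuousLinearMap.id ℂ H)] := by
  obtain ⟨K, _, D, hK, h0, hT⟩ := hQ.exists_blockOp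
  have key (c k c' k' : ℂ)
      (h : AttainsNorm
        (Q + c • ContinuousLinearMap.adjoint Q + k • ContinuousLinearMap.id ℂ H)) :
      AttainsNorm
        (Q + c' • ContinuousLinearMap.adjoint Q + k' • ContinuousLinearMap.id ℂ H) := by
    obtain ⟨α, β, hαβ⟩ := hT c k
    obtain ⟨α', β', hαβ'⟩ := hT c' k'
    rw [hαβ']
    rw [hαβ] at h
    by_cases hD : D = 0
    · subst hD
      exact attainsNorm_blockOp_zero K α' β' c'
    · exact (attainsNorm_blockOp_iff hK h0 hD).mpr ((attainsNorm_blockOp_iff hK h0 hD).mp h)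
  have hQ0 : Q + (0 : ℂ) • ContinuousLinearMap.adjoint Q
      + (0 : ℂ) • ContinuousLinearMap.id ℂ H = Q := by simp
  tfae_have 1 → 2 := fun h c k => key 0 0 c k (by rwa [hQ0])
  tfae_have 2 → 3 := fun h => ⟨0, 0, h 0 0⟩
  tfae_have 3 → 1 := fun ⟨c, k, h⟩ => by simpa only [hQ0] using key c k 0 0 h
  tfae_finish
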